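/- Let $f:\mathbb R^n\to\mathbb R$ be twice continuously differentiable, let $\varphi:\mathbb R^n\to(-\infty,\infty]$ be proper and lower semicontinuous, and let $\tau>0$. Let $\bar x$ be a stationary point of $\psi=f+\varphi$, i.e. $0\in\partial\psi(\bar x)$, where $\partial$ is the limiting subdifferential, and set $\bar v=-\nabla f(\bar x)$ and $\bar z=\bar x+\tau\bar v$. Write $\iota_C$ for the indicator function of a set $C$ (equal to $0$ on $C$ and $+\infty$ off $C$), and let $$\mathrm d^2\varphi(x|v)(h)=\liminf_{t\downarrow0,\ h'\to h}\Delta_t^2\varphi(x|v)(h'),\qquad \Delta_t^2\varphi(x|v)(h)=\frac{\varphi(x+th)-\varphi(x)-t\langle v,h\rangle}{\frac12t^2},$$ be the second subderivative of $\varphi$ at $x$ for $v$. The function $\varphi$ is twice epi-differentiable at $x$ for $v$ if the functions $\Delta_t^2\varphi(x|v)$ epi-converge as $t\downarrow0$. Assume: (A.1) $\varphi$ is globally prox-regular at $\bar x$ for $\bar v\in\partial\varphi(\bar x)$ with constant $\rho$, and $\tau\rho<1$. That is, $\varphi$ is locally lower semicontinuous at $\bar x$ and there is $\epsilon>0$ such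 that $$\varphi(x')\ge\varphi(x)+\langle v,x'-x\rangle-\tfrac{\rho}{2}\|x'-x\|^2\qquad\text{for all }x'\in\mathbb R^n,$$ whenever $\|x-\bar x\|<\epsilon$, $\|v-\bar v\|<\epsilon$, $v\in\partial\varphi(x)$ and $\varphi(x)<\varphi(\bar x)+\epsilon$. (A.2) $\varphi$ is twice epi-differentiable at $\bar x$ for $\bar v$, and $\mathrm d^2\varphi(\bar x|\bar v)(h)=\langle h,Qh\rangle+\iota_S(h)$ for all $h\in\mathbb R^n$, where $S\subseteq\mathbb R^n$ is a closed convex cone and $Q\in\mathbb R^{n\times n}$ is symmetric with range contained in $\mathsf A:=\mathrm{aff}(S)$. Assume further that there is a sequence $(x^k,v^k)\to(\bar x,\bar v)$ with $v^k\in\partial\varphi(x^k)$ such that, for every $k$, $\varphi$ is twice epi-differentiable at $x^k$ for $v^k$ and $\mathrm d^2\varphi(x^k|v^k)$ is generalized quadratic (the sum of a quadratic form and the indicator function of a linear subspace), and such that the functions $\mathrm d^2\varphi(x^k|v^k)$ epi-converge, as $k\to\infty$, to $w\mapsto\langle w,Qw\rangle+\iota_{\mathsf A}(w)$. Then $I+\tau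 Q$ is invertible, the proximity operator $\mathrm{prox}_{\tau\varphi}(z)=\operatorname{argmin}_y\{\varphi(y)+\frac1{2\tau}\|z-y\|^2\}$ is single-valued and Lipschitz continuous around $\bar z$, and $$\Pi_{\mathsf A}(I+\tau Q)^{-1}\Pi_{\mathsf A}\in\partial\,\mathrm{prox}_{\tau\varphi}(\bar z),$$ where $\Pi_{\mathsf A}$ is the orthogonal projection onto $\mathsf A$ and $\partial\,\mathrm{prox}_{\tau\varphi}(\bar z)$ is Clarke's generalized Jacobian, i.e. the convex hull of the Bouligand subdifferential (the set of limits of derivatives at points of differentiability converging to $\bar z$). -/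

import Mathlib

open Filter Topology
open scoped RealInnerProductSpace

namespace ProxVar

noncomputable section

/-- The space `ℝⁿ` with its Euclidean norm and inner product. Symmetric `n × n` matrices are
represented by self-adjoint continuous linear maps `Vec n →L[ℝ] Vec n`. -/
abbrev Vec (n : ℕ) : Type := EuclideanSpace ℝ (Fin n)

variable {n : ℕ}

/-- `φ` is proper: never `-∞` and not identically `+∞`. -/
def Proper (φ : Vec n → EReal) : Prop :=
  (∀ x, φ x ≠ ⊥) ∧ ∃ x, φ x ≠ ⊤

open Classical in
/-- Indicator function of a set in the sense of convex analysis: `0` on `C`, `+∞` off `C`. -/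
def indic (C : Set (Vec n)) (w : Vec n) : EReal := if w ∈ C then 0 else ⊤

/-- `w ↦ ⟨w, Q w⟩ + ι_C(w)`. -/
def quadOn (Q : Vec n →L[ℝ] Vec n) (C : Set (Vec n)) (w : Vec n) : EReal :=
  ((⟪w, Q w⟫ : ℝ) : EReal) + indic C w

/-- Generalized quadratic functions: a quadratic form plus the indicator of a linear subspace. -/
def IsGeneralizedQuadratic (q : Vec n → EReal) : Prop :=
  ∃ (M : Vec n →L[ℝ] Vec n) (L : Submodule ℝ (Vec n)),
    IsSelfAdjoint M ∧ ∀ w, q w = quadOn M (L : Set (Vec n)) w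

/-- Regular (Fréchet) subdifferential:
`φ y ≥ φ x + ⟨v, y - x⟩ + o(‖y - x‖)`, for `x` in the domain of `φ`. -/
def regSubdiff (φ : Vec n → EReal) (x : Vec n) : Set (Vec n) :=
  {v | φ x ≠ ⊤ ∧ ∀ ε : ℝ, 0 < ε → ∀ᶠ y in 𝓝 x,
    φ x + ((⟪v, y - x⟫ - ε * ‖y - x‖ : ℝ) : EReal) ≤ φ y}

/-- (Limiting) subdifferential: the outer limit of the regular subdifferentials as
`y → x` and `φ y → φ x`, for `x` in the domain of `φ`. -/
def subdiff (φ : Vec n → EReal) (x : Vec n) : Set (Vec n) :=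
  {v | φ x ≠ ⊤ ∧ ∃ (y u : ℕ → Vec n), Tendsto y atTop (𝓝 x) ∧
    Tendsto (fun k => φ (y k)) atTop (𝓝 (φ x)) ∧
    (∀ k, u k ∈ regSubdiff φ (y k)) ∧ Tendsto u atTop (𝓝 v)}

/-- Epi-convergence of a sequence of extended real-valued functions, in its sequential form. -/
def EpiConverges (θ : ℕ → Vec n → EReal) (θ₀ : Vec n → EReal) : Prop :=
  ∀ x : Vec n,
    (∀ y : ℕ → Vec n, Tendsto y atTop (𝓝 x) →
      θ₀ x ≤ liminf (fun k => θ k (y k)) atTop) ∧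
    (∃ y : ℕ → Vec n, Tendsto y atTop (𝓝 x) ∧
      limsup (fun k => θ k (y k)) atTop ≤ θ₀ x)

/-- Second-order difference quotient
`(φ (x + t h) - φ x - t ⟨α, h⟩) / (t² / 2)`; used for `t > 0` and `φ x` finite. -/
def diffQuot₂ (φ : Vec n → EReal) (x α : Vec n) (t : ℝ) (h : Vec n) : EReal :=
  (φ (x + t • h) - φ x - ((t * ⟪α, h⟫ : ℝ) : EReal)) / ((t ^ 2 / 2 : ℝ) : EReal)

/-- Second subderivative: the lower limit of the second-order difference quotients as
`t ↓ 0` and `h' → h`. -/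
def secondSubderiv (φ : Vec n → EReal) (x α : Vec n) (h : Vec n) : EReal :=
  liminf (fun p : ℝ × Vec n => diffQuot₂ φ x α p.1 p.2) (𝓝[>] (0 : ℝ) ×ˢ 𝓝 h)

/-- Twice epi-differentiability of `φ` at `x` for `α`: the second-order difference quotients
epi-converge as `t ↓ 0`. -/
def TwiceEpiDifferentiableAt (φ : Vec n → EReal) (x α : Vec n) : Prop :=
  ∃ θ₀ : Vec n → EReal, ∀ t : ℕ → ℝ, (∀ k, 0 < t k) → Tendsto t atTop (𝓝 0) →
    EpiConverges (fun k => diffQuot₂ φ x α (t k)) θ₀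

/-- Local lower semicontinuity at `x` (closedness of the sublevel sets near `x`, for levels up to
a little above `φ x`). -/
def LocallyLscAt (φ : Vec n → EReal) (x : Vec n) : Prop :=
  ∃ ε : ℝ, 0 < ε ∧ ∀ a : EReal, a ≤ φ x + (ε : EReal) →
    IsClosed {y | y ∈ Metric.closedBall x ε ∧ φ y ≤ a}

/-- Global prox-regularity of `φ` at `xbar` for `vbar ∈ ∂φ(xbar)` with constant `ρ`. -/
def GloballyProxRegular (φ : Vec n → EReal) (xbar vbar : Vec n) (ρ : ℝ) : Prop :=
  vbar ∈ subdiff φ xbar ∧ LocallyLscAt φ xbar ∧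
  ∃ ε : ℝ, 0 < ε ∧ ∀ x v : Vec n, ‖x - xbar‖ < ε → ‖v - vbar‖ < ε →
    v ∈ subdiff φ x → φ x < φ xbar + (ε : EReal) →
    ∀ x' : Vec n, φ x + ((⟪v, x' - x⟫ - ρ / 2 * ‖x' - x‖ ^ 2 : ℝ) : EReal) ≤ φ x'

/-- The (set-valued) proximity operator: the minimizers of
`y ↦ φ y + ‖z - y‖² / (2 τ)`. -/
def prox (φ : Vec n → EReal) (τ : ℝ) (z : Vec n) : Set (Vec n) :=
  {y | IsMinOn (fun y => φ y + ((1 / (2 * τ) * ‖z - y‖ ^ 2 : ℝ) : EReal)) Set.univ y}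

/-- Around `z` the set-valued map `T` is single-valued and Lipschitz continuous, and there it
coincides with the function `F`. -/
def IsLipschitzLocalization (T : Vec n → Set (Vec n)) (z : Vec n) (F : Vec n → Vec n) : Prop :=
  ∃ K : NNReal, ∃ U ∈ 𝓝 z, LipschitzOnWith K F U ∧ ∀ y ∈ U, T y = {F y}

/-- Bouligand subdifferential of `F` at `x`. -/
def bouligandSubdiff (F : Vec n → Vec n) (x : Vec n) : Set (Vec n →L[ℝ] Vec n) :=
  {V | ∃ y : ℕ → Vec n, Tendsto y atTop (𝓝 x) ∧ (∀ k, DifferentiableAt ℝ F (y k)) ∧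
    Tendsto (fun k => fderiv ℝ F (y k)) atTop (𝓝 V)}

/-- Clarke's generalized Jacobian of `F` at `x`. -/
def clarkeJacobian (F : Vec n → Vec n) (x : Vec n) : Set (Vec n →L[ℝ] Vec n) :=
  convexHull ℝ (bouligandSubdiff F x)

/-- Closed convex cones (nonempty, hence containing the origin). -/
structure IsClosedConvexCone (S : Set (Vec n)) : Prop where
  nonempty : S.Nonempty
  isClosed : IsClosed S
  convex : Convex ℝ S
  smul_mem : ∀ c : ℝ, 0 ≤ c → ∀ x ∈ S, c • x ∈ S

/-- The affine hull of a cone, as a linear subspace (see `coe_affCone`). -/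
def affCone (S : Set (Vec n)) : Submodule ℝ (Vec n) := Submodule.span ℝ S

theorem coe_affCone {S : Set (Vec n)} (hS : IsClosedConvexCone S) :
    (affCone S : Set (Vec n)) = affineSpan ℝ S := by
  obtain ⟨x, hx⟩ := hS.nonempty
  have h0 : (0 : Vec n) ∈ S := by simpa using hS.smul_mem 0 le_rfl x hx
  apply Set.Subset.antisymm
  · intro y hy
    have hle : Submodule.span ℝ S ≤ vectorSpan ℝ S := by
      refine Submodule.span_le.mpr fun s hs => ?_
      simpa using vsub_mem_vectorSpan ℝ hs h0
    have := vadd_mem_affineSpan_of_mem_affineSpan_of_mem_vectorSpan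
      (mem_affineSpan ℝ h0) (hle hy)
    simpa using this
  · intro y hy
    have hle : affineSpan ℝ S ≤ (Submodule.span ℝ S).toAffineSubspace :=
      affineSpan_le.mpr fun s hs => Submodule.subset_span hs
    exact hle hy

/-- `ψ = f + φ`. -/
def objective (f : Vec n → ℝ) (φ : Vec n → EReal) (x : Vec n) : EReal := (f x : EReal) + φ x

/-- Stationary points: `0 ∈ ∂ψ(x)`. -/
def crit (ψ : Vec n → EReal) : Set (Vec n) := {x | (0 : Vec n) ∈ subdiff ψ x}

end

end ProxVar

open ProxVar

/-!
The operator `L = Π (1 + τ Q)⁻¹ Π`, with `Π` the projection onto `A = span S`, is the derivative of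
the proximity operator at `zbar` in every direction of some open set, and this puts it into Clarke's
generalized Jacobian.

*Localization.* Near `zbar` every minimizer of the proximal problem lies, together with its value and
its subgradient, in the region where the prox-regularity inequality holds. Two such inequalities give
`(1 - τ ρ) ‖F z₁ - F z₂‖² ≤ ⟪z₁ - z₂, F z₁ - F z₂⟫`, hence single-valuedness and Lipschitz
continuity (`exists_prox_localization`).

*Directional derivatives.* Rescaling `z = zbar + t w`, `y = xbar + t h` turns the proximal problem
into the minimization of `Δ_t²φ(xbar|vbar)(h) + ‖w - h‖² / τ`. Epi-convergence forces its minimizers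
to converge to the minimizer of `⟪h, Q h⟫ + ι_S(h) + ‖w - h‖² / τ`, provided `1 + τ Q` is positive
definite (`tendsto_slope_prox`). For small `τ` this is automatic, and every `h ∈ S` is the limit
for `w = h + τ Q h`; the monotonicity inequality then passes to differences of points of `S` and gives
`⟪h, Q h⟫ ≥ -ρ ‖h‖²` on all of `A = S - S` (`neg_mul_norm_sq_le_inner_of_mem_affCone`). So `1 + τ Q`
is positive definite for the given `τ` as well, in particular invertible. The cone `S` has interior
points relative to `A`, so the limit is `L w` for all `w` in a ball.

*Passage to the generalized Jacobian.* If `L` were outside this compact convex set, a linear functional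
would separate it from all derivatives of `F` near `zbar`. On the ball of directions the difference
quotients of `F` converge to `L`, so by Rademacher's theorem and integration by parts the averages of
the derivatives of `F` over small shifted balls converge to `L`, a contradiction
(`mem_clarkeJacobian_of_tendsto_slope`).
-/

/-! ### Convex hulls of compact sets -/

/-- In finite dimension the convex hull of a compact set is compact: by Carathéodory's theorem it
is a finite union of continuous images of `stdSimplex × sᵏ`, `k ≤ dim E + 1`. -/
theorem IsCompact.convexHull_of_finiteDimensional {E : Type*} [NormedAddCommGroup E]
    [NormedSpace ℝ E] [FiniteDimensional ℝ E] {s : Set E} (hs : IsCompact s) :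
    IsCompact (convexHull ℝ s) := by
  have key : convexHull ℝ s = ⋃ k : Fin (Module.finrank ℝ E + 2),
      (fun p : (Fin k → ℝ) × (Fin k → E) => ∑ i, p.1 i • p.2 i) ''
        (stdSimplex ℝ (Fin k) ×ˢ Set.pi Set.univ fun _ => s) := by
    apply Set.Subset.antisymm
    · intro x hx
      obtain ⟨ι, hι, z, w, hz, hind, hw, hw1, hx⟩ := eq_pos_convex_span_of_mem_convexHull hx
      have hcard : Fintype.card ι ≤ Module.finrank ℝ E + 1 :=
        hind.card_le_finrank_succ.trans (Nat.succ_le_succ (Submodule.finrank_le _))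
      let e := (Fintype.equivFin ι).symm
      refine Set.mem_iUnion.2 ⟨⟨Fintype.card ι, by omega⟩, (w ∘ e, z ∘ e), ⟨⟨?_, ?_⟩, ?_⟩, ?_⟩
      · exact fun i => (hw _).le
      · exact (Equiv.sum_comp e w).trans hw1
      · exact fun i _ => hz ⟨e i, rfl⟩
      · exact (Equiv.sum_comp e fun i => w i • z i).trans hx
    · refine Set.iUnion_subset fun k => ?_
      rintro _ ⟨⟨w, z⟩, ⟨hw, hz⟩, rfl⟩
      exact (convex_convexHull ℝ s).sum_mem (fun i _ => hw.1 i) hw.2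
        fun i _ => subset_convexHull ℝ s (hz i trivial)
  rw [key]
  refine isCompact_iUnion fun k => ?_
  refine ((isCompact_stdSimplex ℝ (Fin k)).prod (isCompact_univ_pi fun _ => hs)).image ?_
  fun_prop

/-! ### Clarke's generalized Jacobian and directional derivatives -/

open MeasureTheory in
/-- If Lipschitz maps `H k` tend to `0` pointwise on a ball, a linear functional of their derivatives
cannot stay above a positive constant there. Such a functional is the divergence of a linear image of
`H k`, so integrating it against a bump function `g` and moving the derivative onto `g` gives
integrals that tend to `0`. -/
theorem nonpos_of_tendsto_zero_of_le_fderiv {n : ℕ} {H : ℕ → Vec n → Vec n} {C : NNReal}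
    (hH : ∀ k, LipschitzWith C (H k)) (hH0 : ∀ k, H k 0 = 0) {w₀ : Vec n} {r : ℝ} (hr : 0 < r)
    (hlim : ∀ w ∈ Metric.closedBall w₀ r, Tendsto (fun k => H k w) atTop (𝓝 0))
    (l : (Vec n →L[ℝ] Vec n) →L[ℝ] ℝ) {c : ℝ}
    (hc : ∀ k, ∀ w ∈ Metric.ball w₀ r, DifferentiableAt ℝ (H k) w → c ≤ l (fderiv ℝ (H k) w)) :
    c ≤ 0 := by
  let e : Fin n → Vec n := fun j => EuclideanSpace.single j 1
  -- the trace form `l M = ∑ⱼ λⱼ (M eⱼ)`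
  let lam : Fin n → Vec n →L[ℝ] ℝ := fun j =>
    l ∘L ContinuousLinearMap.smulRightL ℝ (Vec n) (Vec n) (EuclideanSpace.proj j)
  have hl : ∀ M : Vec n →L[ℝ] Vec n, l M = ∑ j, lam j (M (e j)) := by
    intro M
    have hM : M = ∑ j, (EuclideanSpace.proj j : Vec n →L[ℝ] ℝ).smulRight (M (e j)) := by
      ext1 x
      conv_lhs => rw [← (EuclideanSpace.basisFun (Fin n) ℝ).sum_repr x]
      simp [e]
    conv_lhs => rw [hM]
    simp [lam]
  let g : ContDiffBump w₀ := ⟨r / 2, r, by positivity, by linarith⟩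
  obtain ⟨D, hD⟩ := ContDiff.lipschitzWith_of_hasCompactSupport (𝕂 := ℝ) (n := 1)
    g.hasCompactSupport g.contDiff (by simp)
  have hgint : Integrable (fun w => g w) (volume : Measure (Vec n)) := g.integrable
  have hlam : ∀ j k, LipschitzWith (‖lam j‖₊ * C) (fun w => lam j (H k w)) :=
    fun j k => (lam j).lipschitz.comp (hH k)
  have hI1 : ∀ j k, Integrable (fun w => lineDeriv ℝ (fun w => lam j (H k w)) w (e j) * g w)
      (volume : Measure (Vec n)) := by
    intro j k
    have h1 : MemLp (fun w => lineDeriv ℝ (fun w => lam j (H k w)) w (e j)) ⊤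
        (volume : Measure (Vec n)) := (hlam j k).memLp_lineDeriv (e j)
    exact h1.integrable_mul (memLp_one_iff_integrable.2 hgint)
  -- integration by parts moves the derivative from `H k` to `g`
  have hle : ∀ k, c * ∫ w, g w ≤
      ∑ j, ∫ w, lineDeriv ℝ g w (-e j) * lam j (H k w) := by
    intro k
    calc c * ∫ w, g w = ∫ w, c * g w := (integral_const_mul _ _).symm
      _ ≤ ∫ w, ∑ j, lineDeriv ℝ (fun w => lam j (H k w)) w (e j) * g w := by
        refine integral_mono_ae (hgint.const_mul c) (integrable_finsetSum _ fun j _ => hI1 j k) ?_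
        filter_upwards [(hH k).ae_differentiableAt] with w hw
        have h1 : ∀ j, lineDeriv ℝ (fun w => lam j (H k w)) w (e j)
            = lam j (fderiv ℝ (H k) w (e j)) := by
          intro j
          exact ((lam j).hasFDerivAt.comp w hw.hasFDerivAt).hasLineDerivAt (e j) |>.lineDeriv
        simp only [h1, ← Finset.sum_mul, ← hl]
        by_cases hwr : w ∈ Metric.ball w₀ r
        · exact mul_le_mul_of_nonneg_right (hc k w hwr hw) g.nonneg
        · have : g w = 0 := g.zero_of_le_dist (by simpa using hwr)
          simp [this]
      _ = ∑ j, ∫ w, lineDeriv ℝ g w (-e j) * lam j (H k w) := by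
        rw [integral_finsetSum _ fun j _ => hI1 j k]
        exact Finset.sum_congr rfl fun j _ =>
          LipschitzWith.integral_lineDeriv_mul_eq (hlam j k) hD g.hasCompactSupport (e j)
  have hlim2 : Tendsto (fun k => ∑ j, ∫ w, lineDeriv ℝ g w (-e j) * lam j (H k w)) atTop (𝓝 0) := by
    rw [show (0 : ℝ) = ∑ j : Fin n, ∫ w : Vec n, (0 : ℝ) by simp]
    refine tendsto_finsetSum _ fun j _ => ?_
    have hgd : ∀ w, lineDeriv ℝ g w (-e j) = fderiv ℝ g w (-e j) := fun w =>
      (g.contDiff (n := 1) |>.differentiable (by simp) w).lineDeriv_eq_fderiv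
    have hgc : Continuous fun w => fderiv ℝ g w (-e j) :=
      (g.contDiff (n := 1) |>.continuous_fderiv (by simp)).clm_apply continuous_const
    have hgi : Integrable (fun w => fderiv ℝ g w (-e j)) (volume : Measure (Vec n)) :=
      hgc.integrable_of_hasCompactSupport (g.hasCompactSupport.fderiv_apply ℝ _)
    have hg0 : ∀ w, w ∉ Metric.closedBall w₀ r → fderiv ℝ g w (-e j) = 0 := by
      intro w hw
      have : w ∉ tsupport (fderiv ℝ g) := fun h => hw (by
        have := tsupport_fderiv_subset ℝ h
        rwa [g.tsupport_eq] at this)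
      rw [image_eq_zero_of_notMem_tsupport this]
      simp
    simp only [hgd]
    refine tendsto_integral_of_dominated_convergence
      (fun w => ‖fderiv ℝ g w (-e j)‖ * (‖lam j‖ * (C * (‖w₀‖ + r)))) ?_
      (hgi.norm.mul_const _) ?_ ?_
    · exact fun k => (hgc.mul ((lam j).continuous.comp (hH k).continuous)).aestronglyMeasurable
    · refine fun k => Eventually.of_forall fun w => ?_
      rw [norm_mul]
      by_cases hw : w ∈ Metric.closedBall w₀ r
      · have h1 : ‖H k w‖ ≤ C * ‖w‖ := by
          simpa [hH0 k, dist_zero_right] using (hH k).dist_le_mul w 0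
        have h2 : ‖w‖ ≤ ‖w₀‖ + r := by
          have h3 : ‖w - w₀‖ ≤ r := by simpa [dist_eq_norm] using hw
          calc ‖w‖ = ‖w₀ + (w - w₀)‖ := by simp
            _ ≤ ‖w₀‖ + r := (norm_add_le _ _).trans (by gcongr)
        gcongr
        exact ((lam j).le_opNorm _).trans (by gcongr; exact h1.trans (by gcongr))
      · simp [hg0 w hw]
    · refine Eventually.of_forall fun w => ?_
      by_cases hw : w ∈ Metric.closedBall w₀ r
      · simpa using (((lam j).continuous.tendsto 0).comp (hlim w hw)).const_mul
          (fderiv ℝ g w (-e j))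
      · simp [hg0 w hw]
  have h0 : c * ∫ w, g w ≤ 0 := ge_of_tendsto' hlim2 hle
  exact nonpos_of_mul_nonpos_left h0 g.integral_pos

/-- Near `x`, a linear functional bounded below by `u` on the Bouligand subdifferential is bounded
below by any `c < u` on the derivatives of a Lipschitz map. -/
theorem exists_ball_le_fderiv_of_lt_bouligandSubdiff {n : ℕ} {F : Vec n → Vec n} {x : Vec n}
    {K : NNReal} {U : Set (Vec n)} (hU : U ∈ 𝓝 x) (hF : LipschitzOnWith K F U)
    (l : (Vec n →L[ℝ] Vec n) →L[ℝ] ℝ) {c u : ℝ} (hcu : c < u)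
    (hl : ∀ V ∈ bouligandSubdiff F x, u < l V) :
    ∃ δ > 0, Metric.ball x δ ⊆ U ∧
      ∀ y ∈ Metric.ball x δ, DifferentiableAt ℝ F y → c ≤ l (fderiv ℝ F y) := by
  obtain ⟨δ₀, hδ₀, hball⟩ := Metric.mem_nhds_iff.1 hU
  have key : ∀ᶠ y in 𝓝 x, DifferentiableAt ℝ F y → c ≤ l (fderiv ℝ F y) := by
    by_contra hcon
    obtain ⟨y, hyx, hy⟩ := exists_seq_forall_of_frequently
      ((not_eventually.1 hcon).and_eventually (Metric.ball_mem_nhds x hδ₀))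
    have hmem : ∀ k, fderiv ℝ F (y k) ∈ Metric.closedBall (0 : Vec n →L[ℝ] Vec n) K := by
      intro k
      simpa using norm_fderiv_le_of_lipschitzOn ℝ
        (Filter.mem_of_superset (Metric.isOpen_ball.mem_nhds (hy k).2) hball) hF
    obtain ⟨V, -, σ, hσ, hV⟩ := (isCompact_closedBall _ _).tendsto_subseq hmem
    have hVB : V ∈ bouligandSubdiff F x :=
      ⟨y ∘ σ, hyx.comp hσ.tendsto_atTop, fun k => (Classical.not_imp.1 (hy (σ k)).1).1, hV⟩
    have h1 : l V ≤ c := le_of_tendsto ((l.continuous.tendsto V).comp hV)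
      (Eventually.of_forall fun k => (not_le.1 (Classical.not_imp.1 (hy (σ k)).1).2).le)
    linarith [hl V hVB]
  obtain ⟨δ, hδ, h⟩ := Metric.eventually_nhds_iff_ball.1 key
  exact ⟨min δ δ₀, lt_min hδ hδ₀,
    (Metric.ball_subset_ball (min_le_right _ _)).trans hball,
    fun y hy => h y (Metric.ball_subset_ball (min_le_left _ _) hy)⟩

theorem isCompact_bouligandSubdiff {n : ℕ} {F : Vec n → Vec n} {x : Vec n}
    {K : NNReal} {U : Set (Vec n)} (hU : U ∈ 𝓝 x) (hF : LipschitzOnWith K F U) :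
    IsCompact (bouligandSubdiff F x) := by
  have hchar : bouligandSubdiff F x =
      {V | MapClusterPt V (𝓝 x ⊓ 𝓟 {y | DifferentiableAt ℝ F y}) (fderiv ℝ F)} := by
    ext V
    constructor
    · rintro ⟨y, hy, hd, hV⟩
      exact MapClusterPt.of_comp (tendsto_inf.2 ⟨hy, tendsto_principal.2 (.of_forall hd)⟩)
        hV.mapClusterPt
    · intro hV
      obtain ⟨y, hVy, hy⟩ := hV.exists_seq_tendsto
      obtain ⟨hyx, hyd⟩ := tendsto_inf.1 hy
      obtain ⟨N, hN⟩ := eventually_atTop.1 (tendsto_principal.1 hyd)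
      exact ⟨fun k => y (k + N), hyx.comp (tendsto_add_atTop_nat N),
        fun k => hN _ (Nat.le_add_left _ _), hVy.comp (tendsto_add_atTop_nat N)⟩
  refine (isCompact_closedBall (0 : Vec n →L[ℝ] Vec n) K).of_isClosed_subset ?_ ?_
  · rw [hchar]
    exact isClosed_setOfPred_clusterPt
  · rintro V ⟨y, hy, -, hV⟩
    refine Metric.isClosed_closedBall.mem_of_tendsto hV ?_
    filter_upwards [hy.eventually (eventually_mem_nhds_iff.2 hU)] with k hk
    simpa using norm_fderiv_le_of_lipschitzOn ℝ hk hF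

/-- If along a sequence `t k ↓ 0` the difference quotients of a Lipschitz map `F` at `x` converge
to `L w` for all `w` in some ball, then `L` belongs to Clarke's generalized Jacobian. Otherwise a
linear functional separates `L` from the derivatives of `F` near `x`, and the rescaled errors
`w ↦ (F (x + t k w) - F x) / t k - L w` contradict `nonpos_of_tendsto_zero_of_le_fderiv`. -/
theorem mem_clarkeJacobian_of_tendsto_slope {n : ℕ} {F : Vec n → Vec n} {x : Vec n}
    {K : NNReal} {U : Set (Vec n)} (hU : U ∈ 𝓝 x) (hF : LipschitzOnWith K F U)
    {L : Vec n →L[ℝ] Vec n} {w₀ : Vec n} {r : ℝ} (hr : 0 < r) {t : ℕ → ℝ} (ht : ∀ k, 0 < t k)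
    (ht0 : Tendsto t atTop (𝓝 0))
    (hlim : ∀ w ∈ Metric.closedBall w₀ r,
      Tendsto (fun k => (t k)⁻¹ • (F (x + t k • w) - F x)) atTop (𝓝 (L w))) :
    L ∈ clarkeJacobian F x := by
  by_contra hL
  obtain ⟨l, u, hlu, hu⟩ := geometric_hahn_banach_point_closed (convex_convexHull ℝ _)
    (isCompact_bouligandSubdiff hU hF).convexHull_of_finiteDimensional.isClosed hL
  obtain ⟨c, hLc, hcu⟩ := exists_between hlu
  obtain ⟨δ, hδ, hδU, hc⟩ := exists_ball_le_fderiv_of_lt_bouligandSubdiff hU hF l hcu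
    fun V hV => hu V (subset_convexHull ℝ _ hV)
  -- Rademacher's theorem and integration by parts are applied to a globally Lipschitz extension
  obtain ⟨G, hG, hFG⟩ := hF.extend_finite_dimension
  have hxU : x ∈ U := mem_of_mem_nhds hU
  -- for large `k` the ball `x + t k • ball w₀ r` lies in `ball x δ`
  have hsmall : ∀ᶠ k in atTop, t k * (‖w₀‖ + r) < δ := by
    have : Tendsto (fun k => t k * (‖w₀‖ + r)) atTop (𝓝 0) := by
      simpa using ht0.mul_const (‖w₀‖ + r)
    exact this.eventually_lt_const hδ
  obtain ⟨N, hN⟩ := eventually_atTop.1 hsmall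
  have hball : ∀ k, ∀ w ∈ Metric.closedBall w₀ r, x + t (k + N) • w ∈ Metric.ball x δ := by
    intro k w hw
    have h3 : ‖w - w₀‖ ≤ r := by simpa [dist_eq_norm] using hw
    have h2 : ‖w‖ ≤ ‖w₀‖ + r := by
      calc ‖w‖ = ‖w₀ + (w - w₀)‖ := by simp
        _ ≤ ‖w₀‖ + r := (norm_add_le _ _).trans (by gcongr)
    have ht' := ht (k + N)
    rw [mem_ball_iff_norm, add_sub_cancel_left, norm_smul, Real.norm_of_nonneg ht'.le]
    exact (mul_le_mul_of_nonneg_left h2 ht'.le).trans_lt (hN _ (Nat.le_add_left _ _))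
  let H : ℕ → Vec n → Vec n := fun k w =>
    (t (k + N))⁻¹ • (G (x + t (k + N) • w) - G x) - L w
  have hHlip : ∀ k, LipschitzWith (lipschitzExtensionConstant (Vec n) * K + ‖L‖₊) (H k) := by
    intro k
    refine LipschitzWith.sub (LipschitzWith.of_dist_le_mul fun a b => ?_) L.lipschitz
    have ht' := ht (k + N)
    have := hG.dist_le_mul (x + t (k + N) • a) (x + t (k + N) • b)
    rw [dist_smul₀, dist_sub_right, norm_inv, Real.norm_of_nonneg ht'.le,
      inv_mul_le_iff₀ ht']
    rw [dist_add_left, dist_smul₀, Real.norm_of_nonneg ht'.le] at this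
    linarith
  have hpos : c - l L ≤ 0 := by
    refine nonpos_of_tendsto_zero_of_le_fderiv (w₀ := w₀) hHlip (fun k => by simp [H]) hr ?_ l ?_
    · intro w hw
      have h1 := (hlim w hw).comp (tendsto_add_atTop_nat N)
      have h2 := h1.sub_const (L w)
      rw [sub_self] at h2
      refine h2.congr fun k => ?_
      simp only [H, Function.comp_apply]
      rw [hFG (hδU (hball k w hw)), hFG hxU]
    · intro k w hw hd
      have ht' := (ht (k + N)).ne'
      have hmem := hball k w (Metric.ball_subset_closedBall hw)
      have hFG' : F =ᶠ[𝓝 (x + t (k + N) • w)] G :=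
        Filter.mem_of_superset (Metric.isOpen_ball.mem_nhds hmem) fun z hz => hFG (hδU hz)
      -- `G` is recovered from `H k` by rescaling
      have hGd : HasFDerivAt G (fderiv ℝ (H k) w + L) (x + t (k + N) • w) := by
        have e1 : G = fun z => t (k + N) • (H k ((t (k + N))⁻¹ • (z - x))
            + L ((t (k + N))⁻¹ • (z - x))) + G x := by
          funext z
          simp [H, smul_smul, ht']
        have hw' : (t (k + N))⁻¹ • ((x + t (k + N) • w) - x) = w := by simp [smul_smul, ht']
        have hin : HasFDerivAt (fun z : Vec n => (t (k + N))⁻¹ • (z - x))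
            ((t (k + N))⁻¹ • ContinuousLinearMap.id ℝ (Vec n)) (x + t (k + N) • w) :=
          ((hasFDerivAt_id _).sub_const x).fun_const_smul _
        have hout : HasFDerivAt (fun y => H k y + L y) (fderiv ℝ (H k) w + L)
            ((t (k + N))⁻¹ • ((x + t (k + N) • w) - x)) := by
          rw [hw']; exact hd.hasFDerivAt.add L.hasFDerivAt
        have := ((hout.comp (x + t (k + N) • w) hin).const_smul (t (k + N))).add_const (G x)
        rw [e1]
        refine this.congr_fderiv ?_
        ext v : 1
        simp [smul_smul, ht']
      have hFd := hGd.congr_of_eventuallyEq hFG'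
      have := hc _ hmem hFd.differentiableAt
      rw [hFd.fderiv, map_add] at this
      linarith
  linarith

/-! ### Localization of the proximity operator -/

theorem mem_prox_iff {n : ℕ} {φ : Vec n → EReal} {τ : ℝ} {z y : Vec n} :
    y ∈ prox φ τ z ↔ ∀ y', φ y + ((1 / (2 * τ) * ‖z - y‖ ^ 2 : ℝ) : EReal)
      ≤ φ y' + ((1 / (2 * τ) * ‖z - y'‖ ^ 2 : ℝ) : EReal) := by
  simp [prox, isMinOn_iff]

/-- If `φ` has a minorant at `x` with slope `v` and curvature `-ρ` and `y` competes with `x` in the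
proximal problem at `z`, then `y` is close to `x` as soon as `z` is close to `x + τ v`. -/
theorem norm_sub_le_of_prox_value_le {n : ℕ} {τ ρ : ℝ} (hτ : 0 < τ) {x v y z : Vec n} {a b : ℝ}
    (hb : a + (⟪v, y - x⟫ - ρ / 2 * ‖y - x‖ ^ 2) ≤ b)
    (h : b + 1 / (2 * τ) * ‖z - y‖ ^ 2 ≤ a + 1 / (2 * τ) * ‖z - x‖ ^ 2) :
    (1 - τ * ρ) * ‖y - x‖ ≤ 2 * ‖z - (x + τ • v)‖ := by
  set d := y - x with hd
  set p := z - (x + τ • v) with hp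
  have e1 : z - x = p + τ • v := by rw [hp]; abel
  have e2 : z - y = (p + τ • v) - d := by rw [hp, hd]; abel
  rw [e1, e2, norm_sub_sq_real, inner_add_left, real_inner_smul_left] at h
  have h2 : (1 - τ * ρ) * ‖d‖ ^ 2 ≤ 2 * ⟪p, d⟫ := by
    have h3 : 1 / (2 * τ) * (‖p + τ • v‖ ^ 2 - 2 * (⟪p, d⟫ + τ * ⟪v, d⟫) + ‖d‖ ^ 2)
        = 1 / (2 * τ) * ‖p + τ • v‖ ^ 2 + (- ⟪p, d⟫ / τ - ⟪v, d⟫ + ‖d‖ ^ 2 / (2 * τ)) := by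
      field_simp
      ring
    have h4 : - ⟪p, d⟫ / τ + ‖d‖ ^ 2 / (2 * τ) - ρ / 2 * ‖d‖ ^ 2 ≤ 0 := by linarith
    have h5 := mul_nonpos_of_nonneg_of_nonpos (by positivity : 0 ≤ 2 * τ) h4
    have h6 : 2 * τ * (- ⟪p, d⟫ / τ + ‖d‖ ^ 2 / (2 * τ) - ρ / 2 * ‖d‖ ^ 2)
        = (1 - τ * ρ) * ‖d‖ ^ 2 - 2 * ⟪p, d⟫ := by
      field_simp
      ring
    linarith
  rcases (norm_nonneg d).eq_or_lt with h0 | h0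
  · rw [← h0]; simp
  · refine le_of_mul_le_mul_right ?_ h0
    have := real_inner_le_norm p d
    nlinarith

/-- Strong monotonicity of a proximal mapping, from the two subgradient inequalities. -/
theorem mul_norm_sub_sq_le_inner_of_subgradient {n : ℕ} {τ ρ : ℝ} (hτ : 0 < τ)
    {z₁ z₂ y₁ y₂ : Vec n} {b₁ b₂ : ℝ}
    (h₁ : b₁ + (⟪τ⁻¹ • (z₁ - y₁), y₂ - y₁⟫ - ρ / 2 * ‖y₂ - y₁‖ ^ 2) ≤ b₂)
    (h₂ : b₂ + (⟪τ⁻¹ • (z₂ - y₂), y₁ - y₂⟫ - ρ / 2 * ‖y₁ - y₂‖ ^ 2) ≤ b₁) :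
    (1 - τ * ρ) * ‖y₁ - y₂‖ ^ 2 ≤ ⟪z₁ - z₂, y₁ - y₂⟫ := by
  rw [norm_sub_rev y₂ y₁, ← neg_sub y₁ y₂, inner_neg_right, real_inner_smul_left,
    inner_sub_left] at h₁
  rw [real_inner_smul_left, inner_sub_left] at h₂
  have e : ‖y₁ - y₂‖ ^ 2 = ⟪y₁, y₁ - y₂⟫ - ⟪y₂, y₁ - y₂⟫ := by
    rw [← inner_sub_left, real_inner_self_eq_norm_sq]
  rw [inner_sub_left]
  have h3 : τ⁻¹ * (⟪z₂, y₁ - y₂⟫ - ⟪y₂, y₁ - y₂⟫) - τ⁻¹ * (⟪z₁, y₁ - y₂⟫ - ⟪y₁, y₁ - y₂⟫)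
      - ρ * ‖y₁ - y₂‖ ^ 2 ≤ 0 := by linarith
  have h4 := mul_nonpos_of_nonneg_of_nonpos hτ.le h3
  have h5 : τ * (τ⁻¹ * (⟪z₂, y₁ - y₂⟫ - ⟪y₂, y₁ - y₂⟫)
      - τ⁻¹ * (⟪z₁, y₁ - y₂⟫ - ⟪y₁, y₁ - y₂⟫) - ρ * ‖y₁ - y₂‖ ^ 2)
      = (⟪z₂, y₁ - y₂⟫ - ⟪y₂, y₁ - y₂⟫) - (⟪z₁, y₁ - y₂⟫ - ⟪y₁, y₁ - y₂⟫)
        - τ * ρ * ‖y₁ - y₂‖ ^ 2 := by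
    field_simp
  rw [h5] at h4
  linarith

theorem regSubdiff_subset_subdiff {n : ℕ} (φ : Vec n → EReal) (x : Vec n) :
    regSubdiff φ x ⊆ subdiff φ x := fun v hv =>
  ⟨hv.1, fun _ => x, fun _ => v, tendsto_const_nhds, tendsto_const_nhds, fun _ => hv,
    tendsto_const_nhds⟩

/-- Fermat's rule for the proximal problem. -/
theorem inv_smul_sub_mem_regSubdiff_of_mem_prox {n : ℕ} {φ : Vec n → EReal} {τ : ℝ} (hτ : 0 < τ)
    {z y : Vec n} (hy : y ∈ prox φ τ z) (hfin : φ y ≠ ⊤) :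
    τ⁻¹ • (z - y) ∈ regSubdiff φ y := by
  refine ⟨hfin, fun ε hε => ?_⟩
  filter_upwards [Metric.ball_mem_nhds y (show 0 < 2 * τ * ε by positivity)] with y' hy'
  have h := mem_prox_iff.1 hy y'
  have hy'' : ‖y' - y‖ < 2 * τ * ε := by simpa [dist_eq_norm] using hy'
  have e : ‖z - y'‖ ^ 2 = ‖z - y‖ ^ 2 - 2 * ⟪z - y, y' - y⟫ + ‖y' - y‖ ^ 2 := by
    rw [← norm_sub_sq_real]; congr 2; abel
  have hr : ⟪τ⁻¹ • (z - y), y' - y⟫ - ε * ‖y' - y‖ + 1 / (2 * τ) * ‖z - y'‖ ^ 2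
      ≤ 1 / (2 * τ) * ‖z - y‖ ^ 2 := by
    rw [e, real_inner_smul_left]
    have h1 : 1 / (2 * τ) * ‖y' - y‖ ^ 2 ≤ ε * ‖y' - y‖ := by
      have : 1 / (2 * τ) * ‖y' - y‖ ≤ ε := by
        rw [one_div, inv_mul_le_iff₀ (by positivity)]; exact hy''.le
      calc 1 / (2 * τ) * ‖y' - y‖ ^ 2 = (1 / (2 * τ) * ‖y' - y‖) * ‖y' - y‖ := by ring
        _ ≤ ε * ‖y' - y‖ := by gcongr
    have h2 : 1 / (2 * τ) * (‖z - y‖ ^ 2 - 2 * ⟪z - y, y' - y⟫ + ‖y' - y‖ ^ 2)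
        = 1 / (2 * τ) * ‖z - y‖ ^ 2 - τ⁻¹ * ⟪z - y, y' - y⟫
          + 1 / (2 * τ) * ‖y' - y‖ ^ 2 := by
      field_simp
    linarith
  have h3 : φ y + ((⟪τ⁻¹ • (z - y), y' - y⟫ - ε * ‖y' - y‖ : ℝ) : EReal)
      + ((1 / (2 * τ) * ‖z - y'‖ ^ 2 : ℝ) : EReal)
      ≤ φ y' + ((1 / (2 * τ) * ‖z - y'‖ ^ 2 : ℝ) : EReal) := by
    refine le_trans ?_ h
    rw [add_assoc, ← EReal.coe_add]
    gcongr
  exact (EReal.addLECancellable_coe _).add_le_add_iff_right.1 h3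

/-- Around `xbar + τ • vbar` the proximity operator of a globally prox-regular function is
single-valued and its inverse is strongly monotone. -/
theorem exists_prox_localization {n : ℕ} {φ : Vec n → EReal} (hbot : ∀ x, φ x ≠ ⊥)
    (hlsc : LowerSemicontinuous φ) {τ ρ : ℝ} (hτ : 0 < τ) (hτρ : τ * ρ < 1) {xbar vbar : Vec n}
    (hpr : GloballyProxRegular φ xbar vbar ρ) :
    ∃ F : Vec n → Vec n, ∃ U ∈ 𝓝 (xbar + τ • vbar), (∀ z ∈ U, prox φ τ z = {F z}) ∧
      (∀ z₁ ∈ U, ∀ z₂ ∈ U,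
        (1 - τ * ρ) * ‖F z₁ - F z₂‖ ^ 2 ≤ ⟪z₁ - z₂, F z₁ - F z₂⟫) ∧
      F (xbar + τ • vbar) = xbar := by
  obtain ⟨hv, -, ε, hε, hsub⟩ := hpr
  obtain ⟨a, ha⟩ : ∃ a : ℝ, φ xbar = a := ⟨_, (EReal.coe_toReal hv.1 (hbot _)).symm⟩
  set zbar := xbar + τ • vbar with hzbar
  have hγ : 0 < 1 - τ * ρ := by linarith
  have hbase : ∀ x', φ xbar + ((⟪vbar, x' - xbar⟫ - ρ / 2 * ‖x' - xbar‖ ^ 2 : ℝ) : EReal)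
      ≤ φ x' := by
    refine hsub xbar vbar (by simpa) (by simpa) hv ?_
    rw [ha, ← EReal.coe_add]
    exact_mod_cast (by linarith : a < a + ε)
  -- the sublevel set `{y | E_z y ≤ E_z xbar}` of the proximal problem
  have hnear : ∀ z y, φ y + ((1 / (2 * τ) * ‖z - y‖ ^ 2 : ℝ) : EReal)
      ≤ φ xbar + ((1 / (2 * τ) * ‖z - xbar‖ ^ 2 : ℝ) : EReal) →
      ∃ b : ℝ, φ y = b ∧ b + 1 / (2 * τ) * ‖z - y‖ ^ 2 ≤ a + 1 / (2 * τ) * ‖z - xbar‖ ^ 2 ∧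
        ‖y - xbar‖ ≤ 2 / (1 - τ * ρ) * ‖z - zbar‖ := by
    intro z y h
    rw [ha, ← EReal.coe_add] at h
    have htop : φ y ≠ ⊤ := by
      intro ht
      rw [ht, EReal.top_add_coe] at h
      exact EReal.coe_ne_top _ (top_le_iff.1 h)
    obtain ⟨b, hb⟩ : ∃ b : ℝ, φ y = b := ⟨_, (EReal.coe_toReal htop (hbot _)).symm⟩
    have hb1 := hbase y
    rw [hb, ← EReal.coe_add] at h
    rw [hb, ha, ← EReal.coe_add] at hb1
    have h' := EReal.coe_le_coe_iff.1 h
    refine ⟨b, hb, h', ?_⟩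
    have := norm_sub_le_of_prox_value_le hτ (EReal.coe_le_coe_iff.1 hb1) h'
    rw [div_mul_eq_mul_div, le_div_iff₀ hγ]
    linarith
  have hexists : ∀ z, ∃ y, y ∈ prox φ τ z := by
    intro z
    have hEl : LowerSemicontinuous
        fun y => φ y + ((1 / (2 * τ) * ‖z - y‖ ^ 2 : ℝ) : EReal) := by
      refine hlsc.add' (Continuous.lowerSemicontinuous ?_) fun y => ?_
      · exact continuous_coe_real_ereal.comp (by fun_prop)
      · exact EReal.continuousAt_add (Or.inr (EReal.coe_ne_bot _)) (Or.inl (hbot _))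
    have hmem : xbar ∈ Metric.closedBall xbar (2 / (1 - τ * ρ) * ‖z - zbar‖) :=
      Metric.mem_closedBall_self (by positivity)
    obtain ⟨y, -, hmin⟩ := LowerSemicontinuousOn.exists_isMinOn ⟨xbar, hmem⟩
      (isCompact_closedBall _ _) (hEl.lowerSemicontinuousOn _)
    refine ⟨y, mem_prox_iff.2 fun y' => ?_⟩
    by_cases hy' : y' ∈ Metric.closedBall xbar (2 / (1 - τ * ρ) * ‖z - zbar‖)
    · exact hmin hy'
    · refine (hmin hmem).trans (le_of_not_ge fun h => hy' ?_)
      obtain ⟨-, -, -, h⟩ := hnear z y' h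
      simpa [dist_eq_norm] using h
  have hnear' : ∀ z y, y ∈ prox φ τ z → ∃ b : ℝ, φ y = b ∧
      b + 1 / (2 * τ) * ‖z - y‖ ^ 2 ≤ a + 1 / (2 * τ) * ‖z - xbar‖ ^ 2 ∧
        ‖y - xbar‖ ≤ 2 / (1 - τ * ρ) * ‖z - zbar‖ :=
    fun z y hy => hnear z y (mem_prox_iff.1 hy xbar)
  -- near `zbar`, minimizers and the associated subgradients lie in the prox-regularity region
  let N : Set (Vec n) := {z | 2 / (1 - τ * ρ) * ‖z - zbar‖ < ε ∧
    τ⁻¹ * (‖z - zbar‖ + 2 / (1 - τ * ρ) * ‖z - zbar‖) < ε ∧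
    τ⁻¹ * (‖z - xbar‖ * (2 / (1 - τ * ρ) * ‖z - zbar‖)) < ε}
  have hN : N ∈ 𝓝 zbar := by
    refine Eventually.and ?_ (Eventually.and ?_ ?_)
    all_goals
      refine Tendsto.eventually_lt_const hε (Continuous.tendsto' (by fun_prop) _ _ ?_)
      simp
  have hsubgrad : ∀ z ∈ N, ∀ y ∈ prox φ τ z, ∀ x',
      φ y + ((⟪τ⁻¹ • (z - y), x' - y⟫ - ρ / 2 * ‖x' - y‖ ^ 2 : ℝ) : EReal) ≤ φ x' := by
    rintro z ⟨hz1, hz2, hz3⟩ y hy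
    obtain ⟨b, hb, hb1, hb2⟩ := hnear' z y hy
    refine hsub y (τ⁻¹ • (z - y)) (hb2.trans_lt hz1) ?_ (regSubdiff_subset_subdiff _ _
      (inv_smul_sub_mem_regSubdiff_of_mem_prox hτ hy (by simp [hb]))) ?_
    · have e : τ⁻¹ • (z - y) - vbar = τ⁻¹ • ((z - zbar) - (y - xbar)) := by
        have : vbar = τ⁻¹ • (τ • vbar) := by rw [smul_smul, inv_mul_cancel₀ hτ.ne', one_smul]
        rw [hzbar]
        conv_lhs => rw [this]
        rw [← smul_sub]
        congr 1
        abel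
      rw [e, norm_smul, Real.norm_of_nonneg (by positivity)]
      refine lt_of_le_of_lt ?_ hz2
      gcongr
      exact (norm_sub_le _ _).trans (by gcongr)
    · rw [hb, ha, ← EReal.coe_add, EReal.coe_lt_coe_iff]
      have e : ‖z - y‖ ^ 2 = ‖z - xbar‖ ^ 2 - 2 * ⟪z - xbar, y - xbar⟫ + ‖y - xbar‖ ^ 2 := by
        rw [← norm_sub_sq_real]; congr 2; abel
      have h1 : ⟪z - xbar, y - xbar⟫ ≤ ‖z - xbar‖ * (2 / (1 - τ * ρ) * ‖z - zbar‖) :=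
        (real_inner_le_norm _ _).trans (by gcongr)
      have h2 : 1 / (2 * τ) * (‖z - xbar‖ ^ 2 - 2 * ⟪z - xbar, y - xbar⟫ + ‖y - xbar‖ ^ 2)
          = 1 / (2 * τ) * ‖z - xbar‖ ^ 2 - τ⁻¹ * ⟪z - xbar, y - xbar⟫
            + 1 / (2 * τ) * ‖y - xbar‖ ^ 2 := by
        field_simp
      have h3 : τ⁻¹ * ⟪z - xbar, y - xbar⟫ < ε := lt_of_le_of_lt (by gcongr) hz3
      have h4 : 0 ≤ 1 / (2 * τ) * ‖y - xbar‖ ^ 2 := by positivity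
      rw [e, h2] at hb1
      linarith
  have hmono : ∀ z₁ ∈ N, ∀ z₂ ∈ N, ∀ y₁ ∈ prox φ τ z₁, ∀ y₂ ∈ prox φ τ z₂,
      (1 - τ * ρ) * ‖y₁ - y₂‖ ^ 2 ≤ ⟪z₁ - z₂, y₁ - y₂⟫ := by
    intro z₁ hz₁ z₂ hz₂ y₁ hy₁ y₂ hy₂
    obtain ⟨b₁, hb₁, -⟩ := hnear' z₁ y₁ hy₁
    obtain ⟨b₂, hb₂, -⟩ := hnear' z₂ y₂ hy₂
    have h₁ := hsubgrad z₁ hz₁ y₁ hy₁ y₂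
    have h₂ := hsubgrad z₂ hz₂ y₂ hy₂ y₁
    rw [hb₁, hb₂, ← EReal.coe_add, EReal.coe_le_coe_iff] at h₁ h₂
    exact mul_norm_sub_sq_le_inner_of_subgradient hτ h₁ h₂
  choose F hF using hexists
  refine ⟨F, N, hN, fun z hz => ?_, fun z₁ hz₁ z₂ hz₂ =>
    hmono z₁ hz₁ z₂ hz₂ _ (hF z₁) _ (hF z₂), ?_⟩
  · refine Set.Subset.antisymm (fun y hy => ?_) (Set.singleton_subset_iff.2 (hF z))
    have h := hmono z hz z hz y hy (F z) (hF z)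
    rw [sub_self, inner_zero_left] at h
    have h0 : ‖y - F z‖ ^ 2 ≤ 0 := by
      by_contra hcon
      nlinarith [not_le.1 hcon]
    have h1 : ‖y - F z‖ = 0 := by nlinarith [norm_nonneg (y - F z)]
    exact sub_eq_zero.1 (norm_eq_zero.1 h1)
  · obtain ⟨-, -, -, h⟩ := hnear' zbar (F zbar) (hF zbar)
    rw [sub_self, norm_zero, mul_zero] at h
    exact sub_eq_zero.1 (norm_le_zero_iff.1 h)

/-- Strong monotonicity of the inverse makes a map Lipschitz. -/
theorem lipschitzOnWith_of_mul_norm_sub_sq_le_inner {n : ℕ} {F : Vec n → Vec n} {U : Set (Vec n)}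
    {γ : ℝ} (hγ : 0 < γ)
    (h : ∀ z₁ ∈ U, ∀ z₂ ∈ U, γ * ‖F z₁ - F z₂‖ ^ 2 ≤ ⟪z₁ - z₂, F z₁ - F z₂⟫) :
    LipschitzOnWith (Real.toNNReal γ⁻¹) F U := by
  refine LipschitzOnWith.of_dist_le_mul fun z₁ hz₁ z₂ hz₂ => ?_
  rw [Real.coe_toNNReal _ (by positivity), dist_eq_norm, dist_eq_norm, le_inv_mul_iff₀ hγ]
  rcases (norm_nonneg (F z₁ - F z₂)).eq_or_lt with h0 | h0
  · rw [← h0]; simp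
  · refine le_of_mul_le_mul_right ?_ h0
    calc γ * ‖F z₁ - F z₂‖ * ‖F z₁ - F z₂‖ = γ * ‖F z₁ - F z₂‖ ^ 2 := by ring
      _ ≤ ⟪z₁ - z₂, F z₁ - F z₂⟫ := h z₁ hz₁ z₂ hz₂
      _ ≤ _ := real_inner_le_norm _ _

/-! ### Second subderivatives and directional derivatives of the proximity operator -/

theorem secondSubderiv_le_liminf {n : ℕ} (φ : Vec n → EReal) (x v : Vec n) {h : Vec n} {t : ℕ → ℝ}
    (ht : ∀ k, 0 < t k) (ht0 : Tendsto t atTop (𝓝 0)) {g : ℕ → Vec n}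
    (hg : Tendsto g atTop (𝓝 h)) :
    secondSubderiv φ x v h ≤ liminf (fun k => diffQuot₂ φ x v (t k) (g k)) atTop := by
  have htends : Tendsto (fun k => (t k, g k)) atTop (𝓝[>] (0 : ℝ) ×ˢ 𝓝 h) :=
    (tendsto_nhdsWithin_iff.2 ⟨ht0, Eventually.of_forall ht⟩).prodMk hg
  have := liminf_le_liminf_of_le (u := fun p : ℝ × Vec n => diffQuot₂ φ x v p.1 p.2) htends
  exact this

/-- Under twice epi-differentiability the second subderivative has recovery sequences along every
`t k ↓ 0`: the epi-limit is not larger than the second subderivative, since the latter is a lower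
limit along some sequence. -/
theorem exists_recovery_secondSubderiv {n : ℕ} {φ : Vec n → EReal} {x v : Vec n}
    (hepi : TwiceEpiDifferentiableAt φ x v) (h : Vec n) {t : ℕ → ℝ}
    (ht : ∀ k, 0 < t k) (ht0 : Tendsto t atTop (𝓝 0)) :
    ∃ g : ℕ → Vec n, Tendsto g atTop (𝓝 h) ∧
      limsup (fun k => diffQuot₂ φ x v (t k) (g k)) atTop ≤ secondSubderiv φ x v h := by
  obtain ⟨θ, hθ⟩ := hepi
  have hle : θ h ≤ secondSubderiv φ x v h := by
    by_contra hlt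
    obtain ⟨c, hc1, hc2⟩ := exists_between (not_le.1 hlt)
    have hfreq : ∃ᶠ p in 𝓝[>] (0 : ℝ) ×ˢ 𝓝 h, diffQuot₂ φ x v p.1 p.2 < c :=
      frequently_lt_of_liminf_lt (by isBoundedDefault) hc1
    have hev : ∀ᶠ p in 𝓝[>] (0 : ℝ) ×ˢ 𝓝 h, 0 < p.1 :=
      tendsto_fst.eventually self_mem_nhdsWithin
    obtain ⟨p, hp, hpc⟩ := exists_seq_forall_of_frequently (hfreq.and_eventually hev)
    have h1 : Tendsto (fun k => (p k).1) atTop (𝓝 0) :=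
      (tendsto_fst.comp hp).mono_right nhdsWithin_le_nhds
    have h2 := (hθ (fun k => (p k).1) (fun k => (hpc k).2) h1 h).1 (fun k => (p k).2)
      (tendsto_snd.comp hp)
    have h3 : liminf (fun k => diffQuot₂ φ x v (p k).1 (p k).2) atTop ≤ c :=
      liminf_le_of_frequently_le' (Frequently.of_forall fun k => (hpc k).1.le)
    exact absurd (h2.trans h3) (not_le.2 hc2)
  obtain ⟨g, hg, hlim⟩ := (hθ t ht ht0 h).2
  exact ⟨g, hg, hlim.trans hle⟩

/-- The proximal problem at `x + τ v + t w`, rescaled by `y = x + t h`, is the minimization of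
`h ↦ Δ_t²φ(x|v)(h) + ‖w - h‖² / τ`. -/
theorem diffQuot₂_le_of_mem_prox {n : ℕ} {φ : Vec n → EReal} (hbot : ∀ x, φ x ≠ ⊥) {x v : Vec n}
    (hx : φ x ≠ ⊤) {τ t : ℝ} (hτ : 0 < τ) (ht : 0 < t) {w h : Vec n}
    (hmem : x + t • h ∈ prox φ τ (x + τ • v + t • w)) (h' : Vec n) :
    diffQuot₂ φ x v t h
      ≤ diffQuot₂ φ x v t h' + (((‖w - h'‖ ^ 2 - ‖w - h‖ ^ 2) / τ : ℝ) : EReal) := by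
  have hreal : ∀ y, φ y ≠ ⊤ → ∃ b : ℝ, φ y = b :=
    fun y hy => ⟨_, (EReal.coe_toReal hy (hbot _)).symm⟩
  have hsq : ∀ g : Vec n, ‖x + τ • v + t • w - (x + t • g)‖ ^ 2
      = ‖τ • v‖ ^ 2 + 2 * (τ * t * (⟪v, w⟫ - ⟪v, g⟫)) + t ^ 2 * ‖w - g‖ ^ 2 := by
    intro g
    have e : x + τ • v + t • w - (x + t • g) = τ • v + t • (w - g) := by
      rw [smul_sub]; abel
    rw [e, norm_add_sq_real, norm_smul t, Real.norm_of_nonneg ht.le, mul_pow,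
      real_inner_smul_left, real_inner_smul_right, inner_sub_right]
    ring
  obtain ⟨a, ha⟩ := hreal x hx
  have hmin := mem_prox_iff.1 hmem
  have hytop : φ (x + t • h) ≠ ⊤ := by
    intro htop
    have := hmin x
    rw [htop, ha, EReal.top_add_coe, ← EReal.coe_add] at this
    exact EReal.coe_ne_top _ (top_le_iff.1 this)
  obtain ⟨b, hb⟩ := hreal _ hytop
  have ht2 : (0 : ℝ) < t ^ 2 / 2 := by positivity
  by_cases htop : φ (x + t • h') = ⊤
  · have : diffQuot₂ φ x v t h' = ⊤ := by
      rw [diffQuot₂, htop, ha, EReal.top_sub_coe, EReal.top_sub_coe]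
      exact EReal.top_div_of_pos_ne_top (by exact_mod_cast ht2) (EReal.coe_ne_top _)
    rw [this, EReal.top_add_coe]
    exact le_top
  · obtain ⟨c, hc⟩ := hreal _ htop
    have h1 := hmin (x + t • h')
    rw [hb, hc, ← EReal.coe_add, ← EReal.coe_add, EReal.coe_le_coe_iff, hsq, hsq] at h1
    rw [diffQuot₂, diffQuot₂, ha, hb, hc, ← EReal.coe_sub, ← EReal.coe_sub, ← EReal.coe_sub,
      ← EReal.coe_sub, ← EReal.coe_div, ← EReal.coe_div, ← EReal.coe_add, EReal.coe_le_coe_iff]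
    rw [div_le_iff₀ ht2, add_mul, div_mul_cancel₀ _ ht2.ne']
    have h2 : ∀ g : Vec n, 1 / (2 * τ) * (‖τ • v‖ ^ 2 + 2 * (τ * t * (⟪v, w⟫ - ⟪v, g⟫))
        + t ^ 2 * ‖w - g‖ ^ 2) = 1 / (2 * τ) * ‖τ • v‖ ^ 2 + t * (⟪v, w⟫ - ⟪v, g⟫)
          + ‖w - g‖ ^ 2 / τ * (t ^ 2 / 2) := by
      intro g
      field_simp
    rw [h2, h2] at h1
    rw [sub_div, sub_mul]
    linarith

theorem quadOn_of_mem {n : ℕ} {Q : Vec n →L[ℝ] Vec n} {C : Set (Vec n)} {w : Vec n} (hw : w ∈ C) :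
    quadOn Q C w = ((⟪w, Q w⟫ : ℝ) : EReal) := by
  simp [quadOn, indic, hw]

theorem quadOn_of_notMem {n : ℕ} {Q : Vec n →L[ℝ] Vec n} {C : Set (Vec n)} {w : Vec n}
    (hw : w ∉ C) : quadOn Q C w = ⊤ := by
  simp [quadOn, indic, hw]

/-- Directional derivatives of the proximity operator: if `d²φ(x|v) = ⟨·, Q·⟩ + ι_S` and `h₀ ∈ S`
solves the limiting quadratic problem in direction `w` with vanishing multiplier on `S`, then `h₀`
is the derivative of the proximity operator in direction `w`. -/
theorem tendsto_slope_prox {n : ℕ} {φ : Vec n → EReal} (hbot : ∀ x, φ x ≠ ⊥) {x v : Vec n}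
    (hx : φ x ≠ ⊤) (hepi : TwiceEpiDifferentiableAt φ x v)
    {Q : Vec n →L[ℝ] Vec n} (hQ : IsSelfAdjoint Q) {S : Set (Vec n)}
    (hd2 : ∀ h, secondSubderiv φ x v h = quadOn Q S h) {τ : ℝ} (hτ : 0 < τ)
    (hpos : ∀ h, h ≠ 0 → 0 < ⟪h, h + τ • Q h⟫)
    {F : Vec n → Vec n} {U : Set (Vec n)} (hU : U ∈ 𝓝 (x + τ • v)) {K : NNReal}
    (hF : LipschitzOnWith K F U) (hprox : ∀ z ∈ U, F z ∈ prox φ τ z) (hFx : F (x + τ • v) = x)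
    {h₀ w : Vec n} (hh₀ : h₀ ∈ S) (hw : ∀ h ∈ S, ⟪w, h⟫ = ⟪h₀ + τ • Q h₀, h⟫)
    {t : ℕ → ℝ} (ht : ∀ k, 0 < t k) (ht0 : Tendsto t atTop (𝓝 0)) :
    Tendsto (fun k => (t k)⁻¹ • (F (x + τ • v + t k • w) - F (x + τ • v))) atTop (𝓝 h₀) := by
  refine tendsto_of_subseq_tendsto fun ns hns => ?_
  have ht0' : Tendsto (fun k => t (ns k)) atTop (𝓝 0) := ht0.comp hns
  have hmemU : ∀ᶠ k in atTop, x + τ • v + t (ns k) • w ∈ U := by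
    have : Tendsto (fun k => x + τ • v + t (ns k) • w) atTop (𝓝 (x + τ • v)) := by
      simpa using (ht0'.smul_const w).const_add (x + τ • v)
    exact this hU
  have hbdd : ∀ᶠ k in atTop, (t (ns k))⁻¹ • (F (x + τ • v + t (ns k) • w) - F (x + τ • v))
      ∈ Metric.closedBall (0 : Vec n) (K * ‖w‖) := by
    filter_upwards [hmemU] with k hk
    have h1 := hF.dist_le_mul _ hk _ (mem_of_mem_nhds hU)
    rw [dist_eq_norm, dist_eq_norm, add_sub_cancel_left, norm_smul,
      Real.norm_of_nonneg (ht _).le] at h1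
    rw [mem_closedBall_zero_iff, norm_smul, norm_inv, Real.norm_of_nonneg (ht _).le,
      inv_mul_le_iff₀ (ht _)]
    linarith
  obtain ⟨hs, -, σ, hσ, hlim⟩ := (isCompact_closedBall _ _).tendsto_subseq' hbdd.frequently
  refine ⟨σ, ?_⟩
  set s : ℕ → ℝ := fun k => t (ns (σ k))
  set g : ℕ → Vec n := fun k => (s k)⁻¹ • (F (x + τ • v + s k • w) - F (x + τ • v)) with hg_def
  have hs0 : Tendsto s atTop (𝓝 0) := ht0'.comp hσ.tendsto_atTop
  have hspos : ∀ k, 0 < s k := fun k => ht _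
  replace hlim : Tendsto g atTop (𝓝 hs) := hlim
  suffices heq : hs = h₀ by rw [← heq]; exact hlim
  obtain ⟨e, he, hlimsup⟩ := exists_recovery_secondSubderiv hepi h₀ hspos hs0
  rw [hd2, quadOn_of_mem hh₀] at hlimsup
  have hcomp : ∀ᶠ k in atTop, diffQuot₂ φ x v (s k) (g k) ≤ diffQuot₂ φ x v (s k) (e k)
      + (((‖w - e k‖ ^ 2 - ‖w - g k‖ ^ 2) / τ : ℝ) : EReal) := by
    filter_upwards [hσ.tendsto_atTop.eventually hmemU] with k hk
    refine diffQuot₂_le_of_mem_prox hbot hx hτ (hspos k) ?_ (e k)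
    have : x + s k • g k = F (x + τ • v + s k • w) := by
      rw [hg_def, smul_smul, mul_inv_cancel₀ (hspos k).ne', one_smul, hFx, add_sub_cancel]
    rw [this]
    exact hprox _ hk
  have hr : Tendsto (fun k => (‖w - e k‖ ^ 2 - ‖w - g k‖ ^ 2) / τ) atTop
      (𝓝 ((‖w - h₀‖ ^ 2 - ‖w - hs‖ ^ 2) / τ)) :=
    (((he.const_sub w).norm.pow 2).sub ((hlim.const_sub w).norm.pow 2)).div_const τ
  -- the cluster point `hs` minimizes the limiting quadratic problem
  have hle : ∀ c : ℝ, ⟪h₀, Q h₀⟫ + (‖w - h₀‖ ^ 2 - ‖w - hs‖ ^ 2) / τ < c →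
      quadOn Q S hs ≤ (c : EReal) := by
    intro c hc
    obtain ⟨η, hη, hηc⟩ : ∃ η > 0,
        (⟪h₀, Q h₀⟫ + η) + ((‖w - h₀‖ ^ 2 - ‖w - hs‖ ^ 2) / τ + η) = c :=
      ⟨(c - (⟪h₀, Q h₀⟫ + (‖w - h₀‖ ^ 2 - ‖w - hs‖ ^ 2) / τ)) / 2, by linarith, by ring⟩
    have h1 : ∀ᶠ k in atTop, diffQuot₂ φ x v (s k) (e k) < ((⟪h₀, Q h₀⟫ + η : ℝ) : EReal) :=
      eventually_lt_of_limsup_lt (hlimsup.trans_lt (by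
        exact_mod_cast (by linarith : ⟪h₀, Q h₀⟫ < ⟪h₀, Q h₀⟫ + η))) (by isBoundedDefault)
    have h2 := hr.eventually_lt_const (lt_add_of_pos_right _ hη)
    have h3 : ∀ᶠ k in atTop, diffQuot₂ φ x v (s k) (g k) ≤ (c : EReal) := by
      filter_upwards [hcomp, h1, h2] with k hk1 hk2 hk3
      refine hk1.trans ((add_le_add hk2.le (EReal.coe_le_coe_iff.2 hk3.le)).trans ?_)
      rw [← EReal.coe_add, hηc]
    rw [← hd2]
    exact (secondSubderiv_le_liminf φ x v hspos hs0 hlim).trans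
      (liminf_le_of_frequently_le' h3.frequently)
  have hsS : hs ∈ S := by
    by_contra hcon
    have := hle _ (lt_add_one _)
    rw [quadOn_of_notMem hcon] at this
    exact EReal.coe_ne_top _ (top_le_iff.1 this)
  have hle' : ⟪hs, Q hs⟫ ≤ ⟪h₀, Q h₀⟫ + (‖w - h₀‖ ^ 2 - ‖w - hs‖ ^ 2) / τ := by
    refine le_of_forall_gt_imp_ge_of_dense fun c hc => ?_
    have := hle c hc
    rwa [quadOn_of_mem hsS, EReal.coe_le_coe_iff] at this
  by_contra hne
  have hp := hpos (hs - h₀) (sub_ne_zero.2 hne)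
  have hsym : ⟪Q h₀, hs⟫ = ⟪h₀, Q hs⟫ := hQ.isSymmetric h₀ hs
  have h1 := hw h₀ hh₀
  have h2 := hw hs hsS
  have h3 := mul_le_mul_of_nonneg_left hle' hτ.le
  rw [mul_add, mul_div_cancel₀ _ hτ.ne', norm_sub_sq_real, norm_sub_sq_real, h1, h2] at h3
  simp only [map_sub, smul_sub, inner_add_left, inner_add_right, inner_sub_left, inner_sub_right,
    real_inner_smul_left, real_inner_smul_right, real_inner_self_eq_norm_sq] at h3 hp
  rw [hsym] at h3
  rw [real_inner_comm (Q h₀) hs, hsym, real_inner_comm h₀ hs] at hp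
  rw [real_inner_comm h₀ (Q h₀)] at h3
  linarith

/-! ### Closed convex cones and their spans -/

theorem ProxVar.IsClosedConvexCone.zero_mem {n : ℕ} {S : Set (Vec n)} (hS : IsClosedConvexCone S) :
    (0 : Vec n) ∈ S := by
  obtain ⟨x, hx⟩ := hS.nonempty
  simpa using hS.smul_mem 0 le_rfl x hx

theorem ProxVar.IsClosedConvexCone.add_mem {n : ℕ} {S : Set (Vec n)} (hS : IsClosedConvexCone S)
    {a b : Vec n} (ha : a ∈ S) (hb : b ∈ S) : a + b ∈ S := by
  have h := hS.smul_mem 2 (by norm_num) _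
    (hS.convex ha hb (by norm_num : (0 : ℝ) ≤ 1 / 2) (by norm_num : (0 : ℝ) ≤ 1 / 2) (by norm_num))
  simpa [smul_add, smul_smul] using h

theorem ProxVar.IsClosedConvexCone.exists_sub_of_mem_affCone {n : ℕ} {S : Set (Vec n)}
    (hS : IsClosedConvexCone S) {h : Vec n} (hh : h ∈ affCone S) :
    ∃ a ∈ S, ∃ b ∈ S, h = a - b := by
  induction hh using Submodule.span_induction with
  | mem x hx => exact ⟨x, hx, 0, hS.zero_mem, by simp⟩
  | zero => exact ⟨0, hS.zero_mem, 0, hS.zero_mem, by simp⟩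
  | add x y _ _ hx hy =>
    obtain ⟨a, ha, b, hb, rfl⟩ := hx
    obtain ⟨a', ha', b', hb', rfl⟩ := hy
    exact ⟨a + a', hS.add_mem ha ha', b + b', hS.add_mem hb hb', by abel⟩
  | smul c x _ hx =>
    obtain ⟨a, ha, b, hb, rfl⟩ := hx
    rcases le_total 0 c with hc | hc
    · exact ⟨c • a, hS.smul_mem c hc a ha, c • b, hS.smul_mem c hc b hb, smul_sub _ _ _⟩
    · refine ⟨-c • b, hS.smul_mem _ (by linarith) b hb, -c • a,
        hS.smul_mem _ (by linarith) a ha, ?_⟩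
      rw [smul_sub, neg_smul, neg_smul]
      abel

/-- The preimage of `S` under the projection onto its span is a full-dimensional convex cone. -/
theorem ProxVar.IsClosedConvexCone.interior_preimage_starProjection_nonempty {n : ℕ}
    {S : Set (Vec n)} (hS : IsClosedConvexCone S) :
    (interior ((affCone S).starProjection ⁻¹' S)).Nonempty := by
  set T : Set (Vec n) := (affCone S).starProjection ⁻¹' S with hT_def
  have hT : IsClosedConvexCone T :=
    { nonempty := ⟨0, by simpa [hT_def] using hS.zero_mem⟩
      isClosed := hS.isClosed.preimage (affCone S).starProjection.continuous
      convex := hS.convex.linear_preimage (affCone S).starProjection.toLinearMap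
      smul_mem := fun c hc x hx => by
        simpa [hT_def] using hS.smul_mem c hc _ hx }
  rw [hT.convex.interior_nonempty_iff_affineSpan_eq_top]
  have hST : S ⊆ T := fun s hs => by
    have : (affCone S).starProjection s = s :=
      Submodule.starProjection_eq_self_iff.2 (Submodule.subset_span hs)
    rwa [hT_def, Set.mem_preimage, this]
  have htop : affCone T = ⊤ := by
    refine Submodule.eq_top_iff'.2 fun x => ?_
    have h1 : (affCone S).starProjection x ∈ affCone T :=
      Submodule.span_mono hST (Submodule.starProjection_apply_mem _ x)
    have h2 : x - (affCone S).starProjection x ∈ affCone T := by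
      refine Submodule.subset_span ?_
      have : (affCone S).starProjection (x - (affCone S).starProjection x) = 0 :=
        (Submodule.starProjection_apply_eq_zero_iff _).2
          (Submodule.sub_starProjection_mem_orthogonal x)
      rw [hT_def, Set.mem_preimage, this]
      exact hS.zero_mem
    simpa using (affCone T).add_mem h1 h2
  rw [← SetLike.coe_set_eq, ← coe_affCone hT, htop]
  rfl

/-! ### Positive definiteness of `1 + τ Q` -/

/-- The quadratic form of the second subderivative inherits the prox-regularity constant on the
whole span of `S`. Two directional derivatives of the proximity operator for a small parameter
`τ`, for which `1 + τ Q` is positive definite, are compared by monotonicity. -/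
theorem neg_mul_norm_sq_le_inner_of_mem_affCone {n : ℕ} {φ : Vec n → EReal}
    (hbot : ∀ x, φ x ≠ ⊥) (hlsc : LowerSemicontinuous φ) {ρ : ℝ} {x v : Vec n}
    (hpr : GloballyProxRegular φ x v ρ) (hepi : TwiceEpiDifferentiableAt φ x v)
    {Q : Vec n →L[ℝ] Vec n} (hQ : IsSelfAdjoint Q) {S : Set (Vec n)} (hS : IsClosedConvexCone S)
    (hd2 : ∀ h, secondSubderiv φ x v h = quadOn Q S h) {h : Vec n} (hh : h ∈ affCone S) :
    -ρ * ‖h‖ ^ 2 ≤ ⟪h, Q h⟫ := by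
  obtain ⟨τ, hτ, hτρ, hτQ⟩ : ∃ τ : ℝ, 0 < τ ∧ τ * ρ < 1 ∧ τ * ‖Q‖ < 1 := by
    have hden : 0 < |ρ| + ‖Q‖ + 1 := by positivity
    refine ⟨(|ρ| + ‖Q‖ + 1)⁻¹, by positivity, ?_, ?_⟩
    · rw [inv_mul_lt_iff₀ hden]
      linarith [le_abs_self ρ, norm_nonneg Q]
    · rw [inv_mul_lt_iff₀ hden]
      linarith [abs_nonneg ρ]
  have hpos : ∀ h, h ≠ 0 → 0 < ⟪h, h + τ • Q h⟫ := by
    intro h hne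
    rw [inner_add_right, real_inner_self_eq_norm_sq, real_inner_smul_right]
    have h1 : |⟪h, Q h⟫| ≤ ‖Q‖ * ‖h‖ ^ 2 :=
      (abs_real_inner_le_norm _ _).trans (by
        calc ‖h‖ * ‖Q h‖ ≤ ‖h‖ * (‖Q‖ * ‖h‖) := by gcongr; exact Q.le_opNorm h
          _ = ‖Q‖ * ‖h‖ ^ 2 := by ring)
    have h2 : 0 < ‖h‖ ^ 2 := by have := norm_pos_iff.2 hne; positivity
    have h3 := mul_le_mul_of_nonneg_left (neg_le_of_abs_le h1) hτ.le
    have h4 := mul_lt_mul_of_pos_right hτQ h2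
    linarith
  obtain ⟨F, U, hU, hprox, hmono, hFx⟩ := exists_prox_localization hbot hlsc hτ hτρ hpr
  have hLip := lipschitzOnWith_of_mul_norm_sub_sq_le_inner (sub_pos.2 hτρ) hmono
  have hmem : ∀ z ∈ U, F z ∈ prox φ τ z := fun z hz => by rw [hprox z hz]; rfl
  obtain ⟨a, ha, b, hb, rfl⟩ := hS.exists_sub_of_mem_affCone hh
  let t : ℕ → ℝ := fun k => 1 / ((k : ℝ) + 1)
  have ht : ∀ k, 0 < t k := fun k => by positivity
  have ht0 : Tendsto t atTop (𝓝 0) := tendsto_one_div_add_atTop_nhds_zero_nat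
  have hslope : ∀ c ∈ S, Tendsto (fun k => (t k)⁻¹ •
      (F (x + τ • v + t k • (c + τ • Q c)) - F (x + τ • v))) atTop (𝓝 c) := fun c hc =>
    tendsto_slope_prox hbot hpr.1.1 hepi hQ hd2 hτ hpos hU hLip hmem hFx hc (fun _ _ => rfl) ht ht0
  have hmemU : ∀ w, ∀ᶠ k in atTop, x + τ • v + t k • w ∈ U := by
    intro w
    have : Tendsto (fun k => x + τ • v + t k • w) atTop (𝓝 (x + τ • v)) := by
      simpa using (ht0.smul_const w).const_add (x + τ • v)
    exact this hU
  have hdiff := (hslope a ha).sub (hslope b hb)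
  have hlim := le_of_tendsto_of_tendsto ((hdiff.norm.pow 2).const_mul (1 - τ * ρ))
    (tendsto_const_nhds (x := (a + τ • Q a) - (b + τ • Q b)) |>.inner hdiff) (by
      filter_upwards [hmemU (a + τ • Q a), hmemU (b + τ • Q b)] with k hka hkb
      have h1 := hmono _ hka _ hkb
      rw [add_sub_add_left_eq_sub, ← smul_sub, real_inner_smul_left] at h1
      rw [← smul_sub, sub_sub_sub_cancel_right, norm_smul, norm_inv,
        Real.norm_of_nonneg (ht k).le, real_inner_smul_right, mul_pow, inv_pow]
      have h2 := mul_le_mul_of_nonneg_left h1 (by positivity : 0 ≤ (t k ^ 2)⁻¹)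
      have htk := (ht k).ne'
      calc _ = (t k ^ 2)⁻¹ * ((1 - τ * ρ) * ‖F (x + τ • v + t k • (a + τ • Q a))
              - F (x + τ • v + t k • (b + τ • Q b))‖ ^ 2) := by ring
        _ ≤ _ := h2
        _ = _ := by field_simp)
  rw [add_sub_add_comm, ← smul_sub, ← map_sub, inner_add_left, real_inner_self_eq_norm_sq,
    real_inner_smul_left, real_inner_comm] at hlim
  refine le_of_mul_le_mul_left ?_ hτ
  linarith

/-- Since `Q` is symmetric with range in `A`, it vanishes on the orthogonal complement of `A`, and the
lower bound on `A` suffices. -/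
theorem inner_add_smul_pos_of_le_on_submodule {n : ℕ} {Q : Vec n →L[ℝ] Vec n}
    (hQ : IsSelfAdjoint Q) {A : Submodule ℝ (Vec n)} (hQA : ∀ w, Q w ∈ A) {τ ρ : ℝ} (hτ : 0 < τ)
    (hτρ : τ * ρ < 1) (hlow : ∀ h ∈ A, -ρ * ‖h‖ ^ 2 ≤ ⟪h, Q h⟫) {h : Vec n} (hne : h ≠ 0) :
    0 < ⟪h, h + τ • Q h⟫ := by
  have hsym : ∀ a b, ⟪Q a, b⟫ = ⟪a, Q b⟫ := hQ.isSymmetric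
  have hinner : ∀ a b, ⟪a, Q b⟫ = ⟪A.starProjection a, Q b⟫ := fun a b => by
    have := A.starProjection_inner_eq_zero a (Q b) (hQA b)
    rwa [inner_sub_left, sub_eq_zero] at this
  have hform : ⟪h, Q h⟫ = ⟪A.starProjection h, Q (A.starProjection h)⟫ := by
    rw [hinner, ← hsym, real_inner_comm, hinner, real_inner_comm, hsym]
  have h1 := hlow _ (A.starProjection_apply_mem h)
  have h2 : ‖A.starProjection h‖ ^ 2 ≤ ‖h‖ ^ 2 := by
    gcongr
    exact A.norm_starProjection_apply_le h
  have h3 : 0 < ‖h‖ ^ 2 := by have := norm_pos_iff.2 hne; positivity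
  rw [inner_add_right, real_inner_self_eq_norm_sq, real_inner_smul_right, hform]
  have h4 := mul_le_mul_of_nonneg_left h1 hτ.le
  rcases le_total (τ * ρ) 0 with h0 | h0
  · nlinarith [mul_nonneg (neg_nonneg.2 h0) (sq_nonneg ‖A.starProjection h‖)]
  · nlinarith [mul_le_mul_of_nonneg_left h2 h0, mul_lt_mul_of_pos_right hτρ h3]

theorem isUnit_of_inner_pos {n : ℕ} {P : Vec n →L[ℝ] Vec n} (hpos : ∀ h, h ≠ 0 → 0 < ⟪h, P h⟫) :
    IsUnit P := by
  have hinj : Function.Injective P.toLinearMap := by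
    refine (injective_iff_map_eq_zero _).2 fun h hP => ?_
    by_contra hne
    have := hpos h hne
    rw [show P h = 0 from hP, inner_zero_right] at this
    exact lt_irrefl _ this
  exact ContinuousLinearMap.isUnit_iff_bijective.2 ⟨hinj, LinearMap.injective_iff_surjective.1 hinj⟩

/-! ### The element of the generalized Jacobian -/

theorem mainTheorem8 (n : ℕ)
    (f : Vec n → ℝ) (hf : ContDiff ℝ 2 f)
    (φ : Vec n → EReal) (hφ_proper : Proper φ) (hφ_lsc : LowerSemicontinuous φ)
    (τ : ℝ) (hτ : 0 < τ) (ρ : ℝ)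
    (xbar vbar zbar : Vec n)
    (hxbar : xbar ∈ crit (objective f φ))
    (hvbar : vbar = -gradient f xbar) (hzbar : zbar = xbar + τ • vbar)
    (hproxreg : GloballyProxRegular φ xbar vbar ρ) (hτρ : τ * ρ < 1)
    (hepi : TwiceEpiDifferentiableAt φ xbar vbar)
    (Q : Vec n →L[ℝ] Vec n) (hQ : IsSelfAdjoint Q)
    (S : Set (Vec n)) (hS : IsClosedConvexCone S)
    (hQS : ∀ w, Q w ∈ affCone S)
    (hd2 : ∀ h, secondSubderiv φ xbar vbar h = quadOn Q S h)
    (hseq : ∃ x v : ℕ → Vec n,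
      (∀ k, v k ∈ subdiff φ (x k)) ∧
      Tendsto x atTop (𝓝 xbar) ∧ Tendsto v atTop (𝓝 vbar) ∧
      (∀ k, TwiceEpiDifferentiableAt φ (x k) (v k)) ∧
      (∀ k, IsGeneralizedQuadratic (secondSubderiv φ (x k) (v k))) ∧
      EpiConverges (fun k => secondSubderiv φ (x k) (v k))
        (quadOn Q (affCone S : Set (Vec n)))) :
    IsUnit (1 + τ • Q) ∧
    ∃ F : Vec n → Vec n, IsLipschitzLocalization (prox φ τ) zbar F ∧
      (affCone S).starProjection ∘L Ring.inverse (1 + τ • Q) ∘L (affCone S).starProjection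
        ∈ clarkeJacobian F zbar := by
  have hbot := hφ_proper.1
  have hpos : ∀ h, h ≠ 0 → 0 < ⟪h, h + τ • Q h⟫ := fun h hne =>
    inner_add_smul_pos_of_le_on_submodule hQ hQS hτ hτρ (fun g hg =>
      neg_mul_norm_sq_le_inner_of_mem_affCone hbot hφ_lsc hproxreg hepi hQ hS hd2 hg) hne
  have hunit : IsUnit (1 + τ • Q) := isUnit_of_inner_pos fun h hne => by simpa using hpos h hne
  obtain ⟨F, U, hU, hprox, hmono, hFx⟩ := exists_prox_localization hbot hφ_lsc hτ hτρ hproxreg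
  have hLip := lipschitzOnWith_of_mul_norm_sub_sq_le_inner (sub_pos.2 hτρ) hmono
  subst hzbar
  refine ⟨hunit, F, ⟨_, U, hU, hLip, hprox⟩, ?_⟩
  set pA := (affCone S).starProjection with hpA
  set R := Ring.inverse (1 + τ • Q)
  have hPR : ∀ w, R w + τ • Q (R w) = w := fun w => by
    have := DFunLike.congr_fun (Ring.mul_inverse_cancel _ hunit) w
    simpa using this
  have hRP : ∀ w, R (w + τ • Q w) = w := fun w => by
    have := DFunLike.congr_fun (Ring.inverse_mul_cancel _ hunit) w
    simpa using this
  have hpA_mem : ∀ w ∈ affCone S, pA w = w := fun w hw => Submodule.starProjection_eq_self_iff.2 hw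
  have hQpA : ∀ w, Q (pA w) = Q w := fun w => by
    refine ext_inner_right ℝ fun u => ?_
    have hsym : ∀ a b, ⟪Q a, b⟫ = ⟪a, Q b⟫ := hQ.isSymmetric
    rw [hsym, hsym, hpA, Submodule.inner_starProjection_left_eq_right, ← hpA, hpA_mem _ (hQS u)]
  -- `pA` commutes with `1 + τ Q`, hence with its inverse `R`
  have hRpA : ∀ w, R (pA w) = pA (R w) := fun w => by
    conv_lhs => rw [← hPR w]
    rw [map_add, map_smul, hpA_mem _ (hQS _), ← hQpA, hRP]
  have hpA_idem : ∀ w, pA (pA w) = pA w := fun w => hpA_mem _ (Submodule.starProjection_apply_mem _ w)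
  have hL : ∀ w, (pA ∘L R ∘L pA) w = pA (R w) := fun w => by
    simp only [ContinuousLinearMap.comp_apply, hRpA, hpA_idem]
  -- the directions `w` with `pA (R w) ∈ S` have an interior point
  obtain ⟨x₀, hx₀⟩ := hS.interior_preimage_starProjection_nonempty
  have hnhds : {w | pA (R w) ∈ S} ∈ 𝓝 (x₀ + τ • Q x₀) := by
    refine (R.continuous.tendsto (x₀ + τ • Q x₀)).eventually_mem (s := pA ⁻¹' S) ?_
    rw [hRP]
    exact mem_interior_iff_mem_nhds.1 hx₀
  obtain ⟨r, hr, hball⟩ := Metric.nhds_basis_closedBall.mem_iff.1 hnhds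
  refine mem_clarkeJacobian_of_tendsto_slope (w₀ := x₀ + τ • Q x₀) hU hLip hr
    (t := fun k : ℕ => 1 / ((k : ℝ) + 1)) (fun k => by positivity)
    tendsto_one_div_add_atTop_nhds_zero_nat fun w hw => ?_
  rw [hL]
  refine tendsto_slope_prox hbot hproxreg.1.1 hepi hQ hd2 hτ hpos hU hLip
    (fun z hz => by rw [hprox z hz]; rfl) hFx (hball hw) (fun h hh => ?_)
    (fun k => by positivity) tendsto_one_div_add_atTop_nhds_zero_nat
  rw [← hRpA, hPR, hpA, Submodule.inner_starProjection_left_eq_right, ← hpA,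
    hpA_mem h (Submodule.subset_span hh)]
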